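/- Fix $\alpha\in(0,1)$. For each $n$, let $\mathcal L_n$ be a law on $\mathbb R\times\mathbb R\times\mathbb R^{p_n}$ (the dimension $p_n$ may vary with $n$) and let $(X,Y,Z)=\{(X_i,Y_i,Z_i)\}_{i=1}^n$ be i.i.d. from $\mathcal L_n$, with probability denoted $\mathbb P_{\mathcal L_n}$. Let $\mu_{n,y}(z)=\mathbb E_{\mathcal L_n}[Y_i\mid Z_i=z]$. A conditional law $\widehat{\mathcal L}_n(X\mid Z=z)$ is learned from the data $(X,Z)$, with mean $\widehat\mu_{n,x}(z)$ and variance $\mathrm{Var}_{\widehat{\mathcal L}_n}[X\mid Z=z]$, and an estimate $\widehat\mu_{n,y}(z)$ of $\mu_{n,y}(z)$ is learned from the data $(Y,Z)$. For $x\in\mathbb R^n$ put $$T_n(x,X,Y,Z)=\frac1{\sqrt n}\sum_{i=1}^n\bigl(x_i-\widehat\mu_{n,x}(Z_i)\bigr)\bigl(Y_i-\widehat\mu_{n,y}(Z_i)\bigr),\qquad T_n=T_n(X,X,Y,Z).$$ Conditionally on the data let $\widetilde X_i\sim\widehat{\mathcal L}_n(X\mid Z=Z_i)$ be independent, $i=1,\dots,n$,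 and let $\widehat S_n^2=\mathrm{Var}[T_n(\widetilde X,X,Y,Z)\mid X,Y,Z]$. Write $\mathbb Q_{q}$ for the $q$-quantile $\inf\{t:\text{cdf}(t)\ge q\}$ and $z_{q}$ for the $q$-quantile of $N(0,1)$. The $\widehat{\mathrm{dCRT}}$ (with infinitely many resamples) and the $\widehat{\mathrm{MX}(2)}$ $F$-test are $$\phi_n^{\widehat{\mathrm{dCRT}}}=\mathbf 1\bigl(T_n>\mathbb Q_{1-\alpha}[T_n(\widetilde X,X,Y,Z)\mid X,Y,Z]\bigr),\qquad \phi_n^{\widehat{\mathrm{MX}(2)}}=\mathbf 1\bigl(T_n/\widehat S_n>z_{1-\alpha}\bigr).$$ Suppose that 1. $\mathbb P_{\mathcal L_n}[\widehat S_n^2\ge\epsilon]\to1$ for some $\epsilon>0$; 2. for every $n$ and every $1\le i\le n$, almost surely $\mathrm{Var}_{\widehat{\mathcal L}_n}[X\mid Z=Z_i]$, $(Y_i-\widehat\mu_{n,y}(Z_i))^2$ and $(Y_i-\mu_{n,y}(Z_i))^2$ are all positive and finite; 3. for some $\delta>0$, $$\frac1{n^{1+\delta/2}}\sum_{i=1}^n|Y_i-\widehat\mu_{n,y}(Z_i)|^{2+\delta}\,\mathbb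 E\bigl[|\widetilde X_i-\widehat\mu_{n,x}(Z_i)|^{2+\delta}\mid X,Y,Z\bigr]\to0\quad\text{in probability};$$ 4. the normalized statistic does not accumulate near $z_{1-\alpha}$: $$\lim_{\delta\to0^+}\ \limsup_{n\to\infty}\ \mathbb P_{\mathcal L_n}\bigl[\,|T_n/\widehat S_n-z_{1-\alpha}|\le\delta\,\bigr]=0.$$ Then $$\lim_{n\to\infty}\mathbb P_{\mathcal L_n}\bigl[\phi_n^{\widehat{\mathrm{dCRT}}}=\phi_n^{\widehat{\mathrm{MX}(2)}}\bigr]=1.$$ -/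

import Mathlib

open MeasureTheory ProbabilityTheory Filter Topology
open scoped ENNReal

noncomputable section

namespace DCRT

/-- One observation `(X, Y, Z)`, with predictor `X`, response `Y` and covariates `Z ∈ ℝᵖ`. -/
abbrev Obs (p : ℕ) : Type := ℝ × ℝ × (Fin p → ℝ)

/-- A data set of `n` observations. -/
abbrev Sample (n p : ℕ) : Type := Fin n → Obs p

/-- `n` pairs consisting of a scalar and a covariate vector: the data `(X, Z)` from which the law of
the predictor is learned, or the data `(Y, Z)` from which the outcome regression is learned. -/
abbrev Pairs (n p : ℕ) : Type := Fin n → ℝ × (Fin p → ℝ)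

variable {n p : ℕ}

/-- The `(X, Z)` part of the data. -/
def xzData (d : Sample n p) : Pairs n p := fun i => ((d i).1, (d i).2.2)

/-- The `(Y, Z)` part of the data. -/
def yzData (d : Sample n p) : Pairs n p := fun i => ((d i).2.1, (d i).2.2)

/-- The law of `n` i.i.d. observations from `L`. -/
def sampleLaw (n : ℕ) (L : Measure (Obs p)) : Measure (Sample n p) :=
  Measure.pi fun _ => L

/-- The conditional mean `μ_y(z) = E_L[Y | Z = z]`, through a regular conditional law of `Y` given
`Z` under `L`. -/
def muY (L : Measure (Obs p)) [IsFiniteMeasure L] (z : Fin p → ℝ) : ℝ :=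
  ∫ y, y ∂(condDistrib (fun o : Obs p => o.2.1) (fun o : Obs p => o.2.2) L z)

/-- A learning procedure for the conditional law of `X` given `Z`: from the training data `(X, Z)`
and a point `z` it returns the learned law of `X` given `Z = z`. -/
abbrev LawLearner (n p : ℕ) : Type := Kernel (Pairs n p × (Fin p → ℝ)) ℝ

/-- A learning procedure for the outcome regression: from the training data `(Y, Z)` and a point `z`
it returns the estimate of `E[Y | Z = z]`. -/
abbrev MeanLearner (n p : ℕ) : Type := Pairs n p → (Fin p → ℝ) → ℝ

/-- The learned conditional law of `Xᵢ` given `Zᵢ`. -/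
def learnedLaw (K : LawLearner n p) (d : Sample n p) (i : Fin n) : Measure ℝ :=
  K (xzData d, (d i).2.2)

/-- The mean `μ̂_x(Zᵢ)` of the learned conditional law of `Xᵢ` given `Zᵢ`. -/
def muHatX (K : LawLearner n p) (d : Sample n p) (i : Fin n) : ℝ :=
  ∫ x, x ∂(learnedLaw K d i)

/-- The estimate `μ̂_y(Zᵢ)`. -/
def muHatY (m : MeanLearner n p) (d : Sample n p) (i : Fin n) : ℝ :=
  m (yzData d) (d i).2.2

/-- The statistic `T(x̃, X, Y, Z)`: the predictors are replaced by `x̃`, and neither regression is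
refit. -/
def resampledStat (K : LawLearner n p) (m : MeanLearner n p) (d : Sample n p)
    (xt : Fin n → ℝ) : ℝ :=
  (√(n : ℝ))⁻¹ * ∑ i, (xt i - muHatX K d i) * ((d i).2.1 - muHatY m d i)

/-- The observed statistic `T(X, Y, Z)`. -/
def stat (K : LawLearner n p) (m : MeanLearner n p) (d : Sample n p) : ℝ :=
  resampledStat K m d fun i => (d i).1

/-- The conditional law of the resampled predictors given the data: independent draws from the
learned conditional laws. -/
def resampleLaw (K : LawLearner n p) (d : Sample n p) : Measure (Fin n → ℝ) :=
  Measure.pi (learnedLaw K d)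

/-- The conditional variance `Ŝ²` of the resampled statistic given the data. -/
def resampleVar (K : LawLearner n p) (m : MeanLearner n p) (d : Sample n p) : ℝ :=
  variance (resampledStat K m d) (resampleLaw K d)

/-- The normalized statistic `T / Ŝ`. -/
def normStat (K : LawLearner n p) (m : MeanLearner n p) (d : Sample n p) : ℝ :=
  stat K m d / √(resampleVar K m d)

/-- The `q`-quantile `inf {t | ν (-∞, t] ≥ q}` of a law `ν` on the real line. -/
def quantile (ν : Measure ℝ) (q : ℝ) : ℝ := sInf {t : ℝ | q ≤ ν.real (Set.Iic t)}

/-- The standard normal quantile `z_q`. -/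
def normalQuantile (q : ℝ) : ℝ := quantile (gaussianReal 0 1) q

/-- The (infinite-resamples) test of level `α` that compares the statistic with the conditional
quantile of the resampled statistic given the data; `1` means rejection. -/
def dCRTHatTest (α : ℝ) (K : LawLearner n p) (m : MeanLearner n p) (d : Sample n p) : ℝ :=
  if stat K m d > quantile ((resampleLaw K d).map (resampledStat K m d)) (1 - α) then 1 else 0

/-- The resampling-free test of level `α` that compares the normalized statistic with the standard
normal quantile; `1` means rejection. -/
def mx2HatTest (α : ℝ) (K : LawLearner n p) (m : MeanLearner n p) (d : Sample n p) : ℝ :=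
  if normStat K m d > normalQuantile (1 - α) then 1 else 0

/-- The Lyapunov ratio
`n^{-(1+δ/2)} ∑ᵢ |Yᵢ - μ̂_y(Zᵢ)|^{2+δ} E[|X̃ᵢ - μ̂_x(Zᵢ)|^{2+δ} | X, Z]`, as an extended nonnegative
number, so that an infinite moment counts as infinite. -/
def lyapunovRatio (δ : ℝ) (K : LawLearner n p) (m : MeanLearner n p) (d : Sample n p) : ℝ≥0∞ :=
  (∑ i, ENNReal.ofReal (|(d i).2.1 - muHatY m d i| ^ (2 + δ)) *
      ∫⁻ x, ENNReal.ofReal (|x - muHatX K d i| ^ (2 + δ)) ∂(learnedLaw K d i)) /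
    ENNReal.ofReal ((n : ℝ) ^ (1 + δ / 2))

/-- Convergence to zero in probability of nonnegative extended random variables, each on its own
probability space. -/
def TendstoZeroInProb {Ω : ℕ → Type*} [∀ n, MeasurableSpace (Ω n)] (P : ∀ n, Measure (Ω n))
    (W : ∀ n, Ω n → ℝ≥0∞) : Prop :=
  ∀ η : ℝ≥0∞, 0 < η → Tendsto (fun n => P n {ω | η ≤ W n ω}) atTop (𝓝 0)

end DCRT

end

noncomputable section

namespace DCRT

/-! ### Bounds for complex products and exponentials -/

/-! Given the data, the resampled statistic is a sum of independent centered variables with variance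
`Ŝ²`. If the Lyapunov ratio is small and `Ŝ²` is bounded below, its normalized law is nearly
standard normal, so its conditional `(1 - α)`-quantile lies between `Ŝ (z - η)` and `Ŝ (z + η)`,
where `z = z_{1-α}`. The two tests can then disagree only if `T / Ŝ` is within `η` of `z`, which is
unlikely by non-accumulation.

The central limit theorem is applied to each fixed data set, so it must be uniform.
`norm_charFun_map_sum_pi_sub_le` bounds the distance of characteristic functions by a function of
`t` times a small `τ`; `exists_forall_measureReal_Iic_sub_lt` turns this into closeness of
distribution functions at one point, by compactness. Hence the threshold `κ` in
`exists_dCRTHatTest_eq_mx2HatTest` depends only on `α`, `δ`, `ε`, `η`, and disagreement is confined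
to three events of small probability. -/

lemma norm_prod_sub_prod_le {ι : Type*} (s : Finset ι) (a b : ι → ℂ)
    (ha : ∀ i ∈ s, ‖a i‖ ≤ 1) (hb : ∀ i ∈ s, ‖b i‖ ≤ 1) :
    ‖∏ i ∈ s, a i - ∏ i ∈ s, b i‖ ≤ ∑ i ∈ s, ‖a i - b i‖ := by
  classical
  induction s using Finset.induction_on with
  | empty => simp
  | insert j s hj ih =>
    rw [Finset.prod_insert hj, Finset.prod_insert hj, Finset.sum_insert hj]
    have ih' := ih (fun i hi => ha i (Finset.mem_insert_of_mem hi))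
      (fun i hi => hb i (Finset.mem_insert_of_mem hi))
    have hbj := hb j (Finset.mem_insert_self j s)
    have hprod : ‖∏ i ∈ s, a i‖ ≤ 1 := by
      rw [norm_prod]
      exact Finset.prod_le_one (fun _ _ => norm_nonneg _)
        (fun i hi => ha i (Finset.mem_insert_of_mem hi))
    calc ‖a j * ∏ i ∈ s, a i - b j * ∏ i ∈ s, b i‖
        = ‖(a j - b j) * ∏ i ∈ s, a i + b j * (∏ i ∈ s, a i - ∏ i ∈ s, b i)‖ := by ring_nf
      _ ≤ ‖a j - b j‖ * ‖∏ i ∈ s, a i‖ + ‖b j‖ * ‖∏ i ∈ s, a i - ∏ i ∈ s, b i‖ :=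
          (norm_add_le _ _).trans (by rw [norm_mul, norm_mul])
      _ ≤ ‖a j - b j‖ * 1 + 1 * ‖∏ i ∈ s, a i - ∏ i ∈ s, b i‖ := by gcongr
      _ ≤ _ := by linarith

lemma norm_cexp_sub_taylor_le_cube {y : ℝ} (hy : |y| ≤ 1) :
    ‖Complex.exp (y * Complex.I) - (1 + y * Complex.I - y ^ 2 / 2)‖ ≤ |y| ^ 3 := by
  have hn : ‖(y : ℂ) * Complex.I‖ = |y| := by simp
  have h := Complex.exp_bound (x := (y : ℂ) * Complex.I) (by rw [hn]; exact hy)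
    (n := 3) (by norm_num)
  have hs : ∑ m ∈ Finset.range 3, ((y : ℂ) * Complex.I) ^ m / (m.factorial : ℂ)
      = 1 + y * Complex.I - y ^ 2 / 2 := by
    simp [Finset.sum_range_succ, mul_pow, Nat.factorial]
    ring
  rw [hs, hn] at h
  refine h.trans ?_
  have : (0 : ℝ) ≤ |y| ^ 3 := by positivity
  norm_num [Nat.factorial]
  linarith

/-- For `|y| > 1` no cancellation is needed: the triangle inequality gives `2 + |y| + y² / 2`, which
is below `4 y²`. -/
lemma norm_cexp_sub_taylor_le_sq (y : ℝ) :
    ‖Complex.exp (y * Complex.I) - (1 + y * Complex.I - y ^ 2 / 2)‖ ≤ 4 * y ^ 2 := by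
  rcases le_or_gt |y| 1 with hy | hy
  · refine (norm_cexp_sub_taylor_le_cube hy).trans ?_
    rw [← sq_abs y]
    nlinarith [abs_nonneg y, sq_nonneg |y|]
  · have h1 : ‖Complex.exp (y * Complex.I)‖ = 1 := Complex.norm_exp_ofReal_mul_I y
    have h2 : ‖(1 + y * Complex.I - y ^ 2 / 2 : ℂ)‖ ≤ 1 + |y| + y ^ 2 / 2 := by
      refine (norm_sub_le _ _).trans ?_
      have h3 := norm_add_le (1 : ℂ) (y * Complex.I)
      have h4 : ‖(y ^ 2 / 2 : ℂ)‖ = y ^ 2 / 2 := by simp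
      rw [h4]
      simp only [norm_one, norm_mul, Complex.norm_real, Real.norm_eq_abs, Complex.norm_I,
        mul_one] at h3
      linarith
    have h3 := norm_sub_le (Complex.exp (y * Complex.I)) (1 + y * Complex.I - y ^ 2 / 2)
    rw [h1] at h3
    have : y ^ 2 = |y| ^ 2 := (sq_abs y).symm
    nlinarith

lemma sq_le_of_lt_abs {τ δ y : ℝ} (hτ : 0 < τ) (hδ : 0 < δ) (hy : τ < |y|) :
    y ^ 2 ≤ τ ^ (-δ) * |y| ^ (2 + δ) := by
  have hy0 : 0 < |y| := hτ.trans hy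
  have h1 : 1 ≤ τ ^ (-δ) * |y| ^ δ := by
    rw [Real.rpow_neg hτ.le, inv_mul_eq_div, one_le_div (by positivity)]
    exact Real.rpow_le_rpow hτ.le hy.le hδ.le
  rw [Real.rpow_add hy0, Real.rpow_two, ← sq_abs y]
  nlinarith [sq_nonneg |y|]

/-- A Taylor bound whose integrated form involves the second and the `(2 + δ)`-th moment only. -/
lemma norm_cexp_sub_taylor_le {τ δ : ℝ} (hτ : 0 < τ) (hτ1 : τ ≤ 1) (hδ : 0 < δ) (y : ℝ) :
    ‖Complex.exp (y * Complex.I) - (1 + y * Complex.I - y ^ 2 / 2)‖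
      ≤ 4 * (τ * y ^ 2 + τ ^ (-δ) * |y| ^ (2 + δ)) := by
  have h0 : 0 ≤ τ ^ (-δ) * |y| ^ (2 + δ) := by positivity
  have h00 : 0 ≤ τ * y ^ 2 := by positivity
  -- Up to `τ` one factor of the cubic bound is traded for `τ`; beyond `τ` the quadratic bound is
  -- raised to the power `2 + δ`.
  rcases le_or_gt |y| τ with hy | hy
  · refine (norm_cexp_sub_taylor_le_cube (hy.trans hτ1)).trans ?_
    have : |y| ^ 3 ≤ τ * y ^ 2 := by
      rw [← sq_abs y, pow_succ' |y| 2]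
      gcongr
    linarith
  · refine (norm_cexp_sub_taylor_le_sq y).trans ?_
    linarith [sq_le_of_lt_abs hτ hδ hy]

lemma abs_exp_neg_sub_le_sq {s : ℝ} (hs : 0 ≤ s) : |Real.exp (-s) - (1 - s)| ≤ s ^ 2 := by
  rcases le_or_gt s 1 with h | h
  · have := Real.norm_exp_sub_one_sub_id_le (x := -s) (by simpa [abs_of_nonneg hs] using h)
    rw [norm_neg, Real.norm_eq_abs, Real.norm_eq_abs, sq_abs] at this
    convert this using 2
    ring
  · have h1 : Real.exp (-s) ≤ 1 := Real.exp_le_one_iff.mpr (by linarith)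
    have h2 := Real.add_one_le_exp (-s)
    rw [abs_le]
    constructor <;> nlinarith

/-! ### Characteristic functions of sums of independent centered variables -/

section CharFun

variable {Ω : Type*} [MeasurableSpace Ω] {P : Measure Ω} [IsProbabilityMeasure P] {X : Ω → ℝ}

lemma integrable_cexp_mul_I (hX : Measurable X) (t : ℝ) :
    Integrable (fun ω => Complex.exp ((t * X ω : ℝ) * Complex.I)) P := by
  refine Integrable.of_bound (C := 1) (by fun_prop) (Eventually.of_forall fun ω => ?_)
  rw [Complex.norm_exp_ofReal_mul_I]

lemma norm_integral_cexp_sub_le (hX : Measurable X) (hX2 : MemLp X 2 P) (hX0 : ∫ ω, X ω ∂P = 0)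
    {τ δ : ℝ} (hτ : 0 < τ) (hτ1 : τ ≤ 1) (hδ : 0 < δ)
    (hM : Integrable (fun ω => |X ω| ^ (2 + δ)) P) (t : ℝ) :
    ‖∫ ω, Complex.exp ((t * X ω : ℝ) * Complex.I) ∂P
        - ((1 - t ^ 2 / 2 * ∫ ω, X ω ^ 2 ∂P : ℝ) : ℂ)‖
      ≤ 4 * (τ * t ^ 2 * ∫ ω, X ω ^ 2 ∂P
          + τ ^ (-δ) * |t| ^ (2 + δ) * ∫ ω, |X ω| ^ (2 + δ) ∂P) := by
  have hX1 : Integrable X P := hX2.integrable (by norm_num)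
  have hXs : Integrable (fun ω => X ω ^ 2) P := hX2.integrable_sq
  have i1 : Integrable (fun ω => ((t * X ω : ℝ) : ℂ) * Complex.I) P :=
    ((hX1.const_mul t).ofReal (𝕜 := ℂ)).mul_const _
  have hsq : (fun ω => ((t * X ω : ℝ) : ℂ) ^ 2 / 2)
      = fun ω => (((t ^ 2 / 2) * X ω ^ 2 : ℝ) : ℂ) := by
    ext ω
    push_cast
    ring
  have i2 : Integrable (fun ω => ((t * X ω : ℝ) : ℂ) ^ 2 / 2) P := by
    rw [hsq]
    exact (hXs.const_mul _).ofReal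
  have i12 : Integrable (fun ω => 1 + ((t * X ω : ℝ) : ℂ) * Complex.I) P :=
    (integrable_const (1 : ℂ)).add i1
  have i3 : Integrable
      (fun ω => (1 + (t * X ω : ℝ) * Complex.I - ((t * X ω : ℝ) : ℂ) ^ 2 / 2)) P := i12.sub i2
  have e1 : ((1 - t ^ 2 / 2 * ∫ ω, X ω ^ 2 ∂P : ℝ) : ℂ)
      = ∫ ω, (1 + (t * X ω : ℝ) * Complex.I - ((t * X ω : ℝ) : ℂ) ^ 2 / 2) ∂P := by
    rw [integral_sub i12 i2, integral_add (integrable_const (1 : ℂ)) i1,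
      integral_mul_const, integral_complex_ofReal, integral_const_mul, hX0, hsq, integral_complex_ofReal,
      integral_const_mul]
    simp
  rw [e1, ← integral_sub (integrable_cexp_mul_I hX t) i3]
  have e2 : 4 * (τ * t ^ 2 * ∫ ω, X ω ^ 2 ∂P
          + τ ^ (-δ) * |t| ^ (2 + δ) * ∫ ω, |X ω| ^ (2 + δ) ∂P)
      = ∫ ω, 4 * (τ * t ^ 2 * X ω ^ 2 + τ ^ (-δ) * |t| ^ (2 + δ) * |X ω| ^ (2 + δ)) ∂P := by
    rw [integral_const_mul, integral_add (hXs.const_mul _) (hM.const_mul _), integral_const_mul,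
      integral_const_mul]
  rw [e2]
  refine norm_integral_le_of_norm_le (((hXs.const_mul _).add (hM.const_mul _)).const_mul _)
    (Eventually.of_forall fun ω => ?_)
  refine (norm_cexp_sub_taylor_le hτ hτ1 hδ (t * X ω)).trans (le_of_eq ?_)
  rw [abs_mul, Real.mul_rpow (abs_nonneg _) (abs_nonneg _)]
  ring

/-- Truncation at `|X| = τ`. It makes each single variance small, the negligibility of summands that
Lyapunov's condition implies. -/
lemma integral_sq_le_of_moment (hX2 : MemLp X 2 P) {τ δ : ℝ} (hτ : 0 < τ) (hδ : 0 < δ)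
    (hM : Integrable (fun ω => |X ω| ^ (2 + δ)) P) :
    ∫ ω, X ω ^ 2 ∂P ≤ τ ^ 2 + τ ^ (-δ) * ∫ ω, |X ω| ^ (2 + δ) ∂P := by
  have e : τ ^ 2 + τ ^ (-δ) * ∫ ω, |X ω| ^ (2 + δ) ∂P
      = ∫ ω, (τ ^ 2 + τ ^ (-δ) * |X ω| ^ (2 + δ)) ∂P := by
    rw [integral_add (integrable_const _) (hM.const_mul _), integral_const_mul]
    simp
  rw [e]
  refine integral_mono hX2.integrable_sq ((integrable_const _).add (hM.const_mul _)) fun ω => ?_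
  have h0 : 0 ≤ τ ^ (-δ) * |X ω| ^ (2 + δ) := by positivity
  rcases le_or_gt |X ω| τ with h | h
  · have : X ω ^ 2 ≤ τ ^ 2 := by
      rw [← sq_abs]
      gcongr
    simp only
    linarith
  · have := sq_le_of_lt_abs hτ hδ h
    simp only
    nlinarith

end CharFun

section CLT

variable {ι : Type*} [Fintype ι] {Ω : ι → Type*} [∀ i, MeasurableSpace (Ω i)]
  {P : ∀ i, Measure (Ω i)} [∀ i, IsProbabilityMeasure (P i)] {X : ∀ i, Ω i → ℝ}

lemma charFun_map_sum_pi (hX : ∀ i, Measurable (X i)) (t : ℝ) :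
    charFun ((Measure.pi P).map fun ω => ∑ i, X i (ω i)) t
      = ∏ i, ∫ ω, Complex.exp ((t * X i ω : ℝ) * Complex.I) ∂(P i) := by
  have hm : Measurable fun ω : (∀ i, Ω i) => ∑ i, X i (ω i) := by fun_prop
  rw [charFun_apply_real, integral_map hm.aemeasurable (by fun_prop),
    ← integral_fintype_prod_eq_prod]
  congr 1 with ω
  rw [← Complex.exp_sum]
  congr 1
  push_cast
  rw [Finset.mul_sum, Finset.sum_mul]

/-- A quantitative Lyapunov central limit theorem for characteristic functions. -/
lemma norm_charFun_map_sum_pi_sub_le (hX : ∀ i, Measurable (X i)) (hX2 : ∀ i, MemLp (X i) 2 (P i))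
    (hX0 : ∀ i, ∫ ω, X i ω ∂(P i) = 0) (hvar : ∑ i, ∫ ω, X i ω ^ 2 ∂(P i) = 1)
    {τ δ : ℝ} (hτ : 0 < τ) (hτ1 : τ ≤ 1) (hδ : 0 < δ)
    (hM : ∀ i, Integrable (fun ω => |X i ω| ^ (2 + δ)) (P i))
    (hL : ∑ i, ∫ ω, |X i ω| ^ (2 + δ) ∂(P i) ≤ τ ^ (1 + δ)) (t : ℝ) :
    ‖charFun ((Measure.pi P).map fun ω => ∑ i, X i (ω i)) t - charFun (gaussianReal 0 1) t‖
      ≤ (4 * (t ^ 2 + |t| ^ (2 + δ)) + t ^ 4 / 2) * τ := by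
  set v : ι → ℝ := fun i => ∫ ω, X i ω ^ 2 ∂(P i) with hv
  set M : ι → ℝ := fun i => ∫ ω, |X i ω| ^ (2 + δ) ∂(P i) with hMdef
  have hv0 : ∀ i, 0 ≤ v i := fun i => integral_nonneg fun ω => sq_nonneg _
  have hM0 : ∀ i, 0 ≤ M i := fun i => integral_nonneg fun ω => by positivity
  -- The exponent `1 + δ` in `hL` is chosen to absorb the loss `τ ^ (-δ)` from truncation and leave
  -- one factor `τ`.
  have hτδ : τ ^ (-δ) * τ ^ (1 + δ) = τ := by
    rw [← Real.rpow_add hτ]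
    simp
  have hML : τ ^ (-δ) * ∑ i, M i ≤ τ := by
    calc τ ^ (-δ) * ∑ i, M i ≤ τ ^ (-δ) * τ ^ (1 + δ) := by gcongr
      _ = τ := hτδ
  have hMle : ∀ i, τ ^ (-δ) * M i ≤ τ := fun i => by
    refine le_trans ?_ hML
    gcongr
    exact Finset.single_le_sum (f := M) (fun j _ => hM0 j) (Finset.mem_univ i)
  have hvle : ∀ i, v i ≤ 2 * τ := fun i => by
    have := integral_sq_le_of_moment (hX2 i) hτ hδ (hM i)
    have h2 := hMle i
    simp only [hv, hMdef] at *
    nlinarith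
  -- As the variances sum to one, the Gaussian splits into factors of variance `v i`, to be compared
  -- one by one.
  have hg : charFun (gaussianReal 0 1) t
      = ∏ i, ((Real.exp (-(t ^ 2 / 2 * v i)) : ℝ) : ℂ) := by
    rw [charFun_gaussianReal, ← Complex.ofReal_prod, ← Real.exp_sum, Finset.sum_neg_distrib,
      ← Finset.mul_sum, hvar]
    push_cast
    congr 1
    simp
  rw [charFun_map_sum_pi hX, hg]
  refine (norm_prod_sub_prod_le _ _ _ (fun i _ => ?_) (fun i _ => ?_)).trans ?_
  · refine (norm_integral_le_integral_norm _).trans ?_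
    simp_rw [Complex.norm_exp_ofReal_mul_I]
    simp
  · rw [Complex.norm_real, Real.norm_eq_abs, Real.abs_exp, Real.exp_le_one_iff]
    have := hv0 i
    simp only [Left.neg_nonpos_iff]
    positivity
  have hterm : ∀ i, ‖∫ ω, Complex.exp ((t * X i ω : ℝ) * Complex.I) ∂(P i)
        - ((Real.exp (-(t ^ 2 / 2 * v i)) : ℝ) : ℂ)‖
      ≤ 4 * (τ * t ^ 2 * v i + |t| ^ (2 + δ) * (τ ^ (-δ) * M i)) + t ^ 4 / 2 * τ * v i := by
    intro i
    have h1 := norm_integral_cexp_sub_le (hX i) (hX2 i) (hX0 i) hτ hτ1 hδ (hM i) t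
    have h2 : ‖((1 - t ^ 2 / 2 * v i : ℝ) : ℂ) - ((Real.exp (-(t ^ 2 / 2 * v i)) : ℝ) : ℂ)‖
        ≤ (t ^ 2 / 2 * v i) ^ 2 := by
      rw [← Complex.ofReal_sub, Complex.norm_real, norm_sub_rev]
      exact abs_exp_neg_sub_le_sq (mul_nonneg (by positivity) (hv0 i))
    have h3 : (t ^ 2 / 2 * v i) ^ 2 ≤ t ^ 4 / 2 * τ * v i := by
      -- Keeping one `v i` linear lets the quadratic errors sum to a multiple of `τ`, whatever the
      -- number of summands.
      have h5 : v i ^ 2 ≤ 2 * τ * v i := by nlinarith [hvle i, hv0 i]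
      calc (t ^ 2 / 2 * v i) ^ 2 = t ^ 4 / 4 * v i ^ 2 := by ring
        _ ≤ t ^ 4 / 4 * (2 * τ * v i) := by gcongr
        _ = _ := by ring
    have h4 := norm_sub_le_norm_sub_add_norm_sub
      (∫ ω, Complex.exp ((t * X i ω : ℝ) * Complex.I) ∂(P i))
      ((1 - t ^ 2 / 2 * v i : ℝ) : ℂ) ((Real.exp (-(t ^ 2 / 2 * v i)) : ℝ) : ℂ)
    simp only [hv, hMdef] at *
    linarith
  refine (Finset.sum_le_sum fun i _ => hterm i).trans ?_
  rw [Finset.sum_add_distrib, ← Finset.mul_sum, Finset.sum_add_distrib, ← Finset.mul_sum,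
    ← Finset.mul_sum, ← Finset.mul_sum, ← Finset.mul_sum, hvar]
  have : |t| ^ (2 + δ) * (τ ^ (-δ) * ∑ i, M i) ≤ |t| ^ (2 + δ) * τ := by gcongr
  linarith

/-- Uniformity in Lévy's continuity theorem, at a point that carries no mass of the limit. -/
lemma exists_forall_measureReal_Iic_sub_lt (γ : Measure ℝ) [IsProbabilityMeasure γ]
    [NullSingletonClass γ] (C : ℝ → ℝ) (x : ℝ) {e : ℝ} (he : 0 < e) :
    ∃ τ : ℝ, 0 < τ ∧ τ ≤ 1 ∧ ∀ ν : Measure ℝ, IsProbabilityMeasure ν →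
      (∀ t, ‖charFun ν t - charFun γ t‖ ≤ C t * τ) →
      |ν.real (Set.Iic x) - γ.real (Set.Iic x)| < e := by
  -- Otherwise there are counterexamples for every `τ = 1 / (k + 1)`; their characteristic functions
  -- converge pointwise, so Lévy's theorem makes their distribution functions converge at `x`.
  by_contra! hcon
  have hpos : ∀ k : ℕ, (0 : ℝ) < 1 / ((k : ℝ) + 1) := fun k => by positivity
  have hle : ∀ k : ℕ, 1 / ((k : ℝ) + 1) ≤ 1 := fun k => by
    rw [div_le_one (by positivity)]
    simp
  choose ν hν hclose hfar using fun k : ℕ => hcon _ (hpos k) (hle k)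
  let νp : ℕ → ProbabilityMeasure ℝ := fun k => ⟨ν k, hν k⟩
  let γp : ProbabilityMeasure ℝ := ⟨γ, inferInstance⟩
  have hconv : Tendsto νp atTop (𝓝 γp) := by
    refine ProbabilityMeasure.tendsto_of_tendsto_charFun fun t => ?_
    rw [tendsto_iff_norm_sub_tendsto_zero]
    have hz : Tendsto (fun k : ℕ => C t * (1 / ((k : ℝ) + 1))) atTop (𝓝 0) := by
      simpa using (tendsto_one_div_add_atTop_nhds_zero_nat (𝕜 := ℝ)).const_mul (C t)
    exact squeeze_zero (fun _ => norm_nonneg _) (fun k => hclose k t) hz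
  have hcdf := ProbabilityMeasure.tendsto_measure_of_null_frontier_of_tendsto' hconv
    (E := Set.Iic x) (by rw [frontier_Iic]; exact measure_singleton (μ := γ) x)
  have hreal : Tendsto (fun k => (ν k).real (Set.Iic x)) atTop (𝓝 (γ.real (Set.Iic x))) :=
    (ENNReal.tendsto_toReal (measure_ne_top γ _)).comp hcdf
  obtain ⟨k, hk⟩ := (Metric.tendsto_nhds.mp hreal e he).exists
  rw [Real.dist_eq] at hk
  exact absurd hk (not_lt.mpr (hfar k))

end CLT

/-! ### Quantiles -/

section Quantile

variable (ν : Measure ℝ) [IsProbabilityMeasure ν] {q : ℝ}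

lemma bddBelow_quantile_set (hq : 0 < q) : BddBelow {t : ℝ | q ≤ ν.real (Set.Iic t)} := by
  obtain ⟨a, ha⟩ := ((tendsto_cdf_atBot ν).eventually_lt_const hq).exists
  refine ⟨a, fun t ht => ?_⟩
  by_contra! h
  have h1 := monotone_cdf ν h.le
  rw [cdf_eq_real ν t] at h1
  exact absurd (ht.trans h1) (not_le.mpr ha)

lemma nonempty_quantile_set (hq : q < 1) : {t : ℝ | q ≤ ν.real (Set.Iic t)}.Nonempty := by
  obtain ⟨a, ha⟩ := ((tendsto_cdf_atTop ν).eventually_const_lt hq).exists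
  exact ⟨a, by rw [cdf_eq_real] at ha; exact ha.le⟩

lemma quantile_le (hq : 0 < q) {b : ℝ} (hb : q ≤ ν.real (Set.Iic b)) : quantile ν q ≤ b :=
  csInf_le (bddBelow_quantile_set ν hq) hb

lemma le_quantile (hq : q < 1) {a : ℝ} (ha : ν.real (Set.Iic a) < q) : a ≤ quantile ν q := by
  refine le_csInf (nonempty_quantile_set ν hq) fun t ht => ?_
  by_contra! h
  exact absurd (ht.trans (measureReal_mono (Set.Iic_subset_Iic.mpr h.le))) (not_le.mpr ha)

lemma measureReal_Iic_lt_of_lt_quantile (hq : 0 < q) {x : ℝ} (hx : x < quantile ν q) :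
    ν.real (Set.Iic x) < q :=
  not_le.mp fun h => (quantile_le ν hq h).not_gt hx

/-- Strict because the normal law charges every nonempty interval. The gap is the room for error in
the normal approximation. -/
lemma lt_measureReal_Iic_of_normalQuantile_lt (hq : q < 1) {x : ℝ} (hx : normalQuantile q < x) :
    q < (gaussianReal 0 1).real (Set.Iic x) := by
  obtain ⟨t, ht, htx⟩ := exists_lt_of_csInf_lt (nonempty_quantile_set (gaussianReal 0 1) hq) hx
  have hpos : 0 < (gaussianReal 0 1).real (Set.Ioc t x) := by
    refine ENNReal.toReal_pos (fun h0 => ?_) (measure_ne_top _ _)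
    have := gaussianReal_absolutelyContinuous' 0 one_ne_zero h0
    rw [Real.volume_Ioc, ENNReal.ofReal_eq_zero] at this
    linarith
  have hunion : Set.Iic x = Set.Iic t ∪ Set.Ioc t x := (Set.Iic_union_Ioc_eq_Iic htx.le).symm
  have hdisj : Disjoint (Set.Iic t) (Set.Ioc t x) :=
    Set.disjoint_left.mpr fun y hy hy' => absurd hy'.1 (not_lt.mpr hy)
  rw [hunion, measureReal_union hdisj measurableSet_Ioc]
  have : q ≤ (gaussianReal 0 1).real (Set.Iic t) := ht
  linarith

end Quantile

/-! ### The Lyapunov theorem for unnormalized sums -/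

/-- Division by `S` reduces to unit variance. The order of quantifiers matters: `κ` precedes `n` and
the laws, so it serves all data sets at once. -/
lemma exists_lyapunov_bound {δ : ℝ} (hδ : 0 < δ) (x : ℝ) {e : ℝ} (he : 0 < e) :
    ∃ κ : ℝ, 0 < κ ∧ ∀ (n : ℕ) (P : Fin n → Measure ℝ), (∀ i, IsProbabilityMeasure (P i)) →
      ∀ X : Fin n → ℝ → ℝ, (∀ i, Measurable (X i)) → (∀ i, MemLp (X i) 2 (P i)) →
      (∀ i, ∫ ω, X i ω ∂(P i) = 0) → ∀ S : ℝ, 0 < S → ∑ i, ∫ ω, X i ω ^ 2 ∂(P i) = S ^ 2 →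
      (∀ i, Integrable (fun ω => |X i ω| ^ (2 + δ)) (P i)) →
      ∑ i, ∫ ω, |X i ω| ^ (2 + δ) ∂(P i) ≤ κ * S ^ (2 + δ) →
      |((Measure.pi P).map fun ω => ∑ i, X i (ω i)).real (Set.Iic (S * x))
        - (gaussianReal 0 1).real (Set.Iic x)| < e := by
  have : NullSingletonClass (gaussianReal 0 1) := nullSingletonClass_gaussianReal one_ne_zero
  obtain ⟨τ, hτ, hτ1, H⟩ := exists_forall_measureReal_Iic_sub_lt (gaussianReal 0 1)
    (fun t => 4 * (t ^ 2 + |t| ^ (2 + δ)) + t ^ 4 / 2) x he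
  refine ⟨τ ^ (1 + δ), by positivity, ?_⟩
  intro n P hP X hX hX2 hX0 S hS hvar hM hL
  have hXm : Measurable fun ω : (Fin n → ℝ) => ∑ i, X i (ω i) := by fun_prop
  have hYm : Measurable fun ω : (Fin n → ℝ) => ∑ i, S⁻¹ * X i (ω i) := by fun_prop
  have habs : ∀ i, (fun ω => |S⁻¹ * X i ω| ^ (2 + δ))
      = fun ω => (S ^ (2 + δ))⁻¹ * |X i ω| ^ (2 + δ) := fun i => by
    ext ω
    rw [abs_mul, Real.mul_rpow (abs_nonneg _) (abs_nonneg _), abs_of_pos (inv_pos.mpr hS),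
      Real.inv_rpow hS.le]
  have hset : ((Measure.pi P).map fun ω => ∑ i, X i (ω i)).real (Set.Iic (S * x))
      = ((Measure.pi P).map fun ω => ∑ i, S⁻¹ * X i (ω i)).real (Set.Iic x) := by
    rw [map_measureReal_apply hXm measurableSet_Iic, map_measureReal_apply hYm measurableSet_Iic]
    congr 1
    ext ω
    simp only [Set.mem_preimage, Set.mem_Iic, ← Finset.mul_sum]
    rw [inv_mul_le_iff₀ hS]
  rw [hset]
  refine H _ (Measure.isProbabilityMeasure_map hYm.aemeasurable) fun t => ?_
  refine norm_charFun_map_sum_pi_sub_le (X := fun i ω => S⁻¹ * X i ω)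
    (fun i => (hX i).const_mul _) (fun i => (hX2 i).const_mul _) (fun i => ?_) ?_ hτ hτ1 hδ
    (fun i => ?_) ?_ t
  · rw [integral_const_mul, hX0, mul_zero]
  · simp_rw [mul_pow, integral_const_mul]
    rw [← Finset.mul_sum, hvar]
    field_simp
  · rw [habs]
    exact (hM i).const_mul _
  · simp_rw [habs, integral_const_mul]
    rw [← Finset.mul_sum, inv_mul_le_iff₀ (by positivity), mul_comm]
    exact hL

/-! ### The resampled statistic given the data -/

section Resample

variable {n p : ℕ} (K : LawLearner n p) [IsMarkovKernel K] (m : MeanLearner n p) (d : Sample n p)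

instance (L : Measure (Obs p)) [IsProbabilityMeasure L] : IsProbabilityMeasure (sampleLaw n L) :=
  inferInstanceAs (IsProbabilityMeasure (Measure.pi fun _ : Fin n => L))

instance (i : Fin n) : IsProbabilityMeasure (learnedLaw K d i) :=
  inferInstanceAs (IsProbabilityMeasure (K _))

instance : IsProbabilityMeasure (resampleLaw K d) :=
  inferInstanceAs (IsProbabilityMeasure (Measure.pi (learnedLaw K d)))


/-- The contribution of the `i`-th resampled predictor to the resampled statistic. -/
def resampledTerm (K : LawLearner n p) (m : MeanLearner n p) (d : Sample n p) (i : Fin n) (x : ℝ) :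
    ℝ :=
  (√(n : ℝ))⁻¹ * ((x - muHatX K d i) * ((d i).2.1 - muHatY m d i))

lemma resampledStat_eq_sum (K : LawLearner n p) (m : MeanLearner n p) (d : Sample n p) :
    resampledStat K m d = fun xt => ∑ i, resampledTerm K m d i (xt i) := by
  ext xt
  simp only [resampledStat, resampledTerm, Finset.mul_sum]

lemma measurable_resampledTerm (K : LawLearner n p) (m : MeanLearner n p) (d : Sample n p)
    (i : Fin n) : Measurable (resampledTerm K m d i) := by
  unfold resampledTerm
  fun_prop

variable {K d}

lemma memLp_id_of_evariance_lt_top {i : Fin n} (h : evariance id (learnedLaw K d i) < ∞) :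
    MemLp id 2 (learnedLaw K d i) :=
  (evariance_lt_top_iff_memLp aestronglyMeasurable_id).mp h

lemma memLp_resampledTerm {i : Fin n} (h : evariance id (learnedLaw K d i) < ∞) :
    MemLp (resampledTerm K m d i) 2 (learnedLaw K d i) :=
  (((memLp_id_of_evariance_lt_top h).sub (memLp_const _)).mul_const _).const_mul _

lemma integral_resampledTerm {i : Fin n} (h : evariance id (learnedLaw K d i) < ∞) :
    ∫ x, resampledTerm K m d i x ∂(learnedLaw K d i) = 0 := by
  have hi : Integrable (fun x : ℝ => x) (learnedLaw K d i) :=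
    (memLp_id_of_evariance_lt_top h).integrable (by norm_num)
  unfold resampledTerm
  rw [integral_const_mul, integral_mul_const, integral_sub hi (integrable_const _)]
  simp [muHatX]

lemma resampleVar_eq_sum_variance (h : ∀ i, evariance id (learnedLaw K d i) < ∞) :
    resampleVar K m d = ∑ i, variance (resampledTerm K m d i) (learnedLaw K d i) := by
  unfold resampleVar resampleLaw
  rw [← variance_sum_pi fun i => memLp_resampledTerm m (h i), resampledStat_eq_sum]
  congr 1
  ext xt
  simp

lemma resampleVar_eq_sum_integral (h : ∀ i, evariance id (learnedLaw K d i) < ∞) :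
    resampleVar K m d = ∑ i, ∫ x, resampledTerm K m d i x ^ 2 ∂(learnedLaw K d i) := by
  rw [resampleVar_eq_sum_variance m h]
  refine Finset.sum_congr rfl fun i _ => ?_
  exact variance_of_integral_eq_zero (measurable_resampledTerm K m d i).aemeasurable
    (integral_resampledTerm m (h i))

/-- This form is visibly measurable in the data. -/
lemma resampleVar_eq_sum_evariance (h : ∀ i, evariance id (learnedLaw K d i) < ∞) :
    resampleVar K m d = ∑ i, ((√(n : ℝ))⁻¹ * ((d i).2.1 - muHatY m d i)) ^ 2 *
      (evariance id (learnedLaw K d i)).toReal := by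
  rw [resampleVar_eq_sum_variance m h]
  refine Finset.sum_congr rfl fun i _ => ?_
  have : resampledTerm K m d i = fun x => ((√(n : ℝ))⁻¹ * ((d i).2.1 - muHatY m d i)) *
      (id x - muHatX K d i) := by
    ext x
    simp only [resampledTerm, id]
    ring
  rw [this, variance_const_mul, variance_sub_const aestronglyMeasurable_id]
  rfl

lemma sum_lintegral_resampledTerm (δ : ℝ) :
    ∑ i, ∫⁻ x, ENNReal.ofReal (|resampledTerm K m d i x| ^ (2 + δ)) ∂(learnedLaw K d i)
      = lyapunovRatio δ K m d := by
  rcases Nat.eq_zero_or_pos n with rfl | hn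
  · simp [lyapunovRatio]
  have hn' : (0 : ℝ) < n := by exact_mod_cast hn
  -- The normalization in the Lyapunov ratio is the `(2 + δ)`-th power of the factor `n^{-1/2}` in
  -- the statistic.
  have hc : |(√(n : ℝ))⁻¹| ^ (2 + δ) = ((n : ℝ) ^ (1 + δ / 2))⁻¹ := by
    rw [abs_of_pos (by positivity), Real.inv_rpow (by positivity), Real.sqrt_eq_rpow,
      ← Real.rpow_mul hn'.le]
    congr 2
    ring
  unfold lyapunovRatio
  rw [ENNReal.div_eq_inv_mul, Finset.mul_sum]
  refine Finset.sum_congr rfl fun i _ => ?_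
  rw [← ENNReal.ofReal_inv_of_pos (by positivity), ← mul_assoc,
    ← ENNReal.ofReal_mul (by positivity), ← lintegral_const_mul _ (by fun_prop)]
  congr 1 with x
  rw [← ENNReal.ofReal_mul (by positivity)]
  congr 1
  rw [resampledTerm, abs_mul, abs_mul, Real.mul_rpow (abs_nonneg _) (by positivity),
    Real.mul_rpow (abs_nonneg _) (abs_nonneg _), hc]
  ring

/-- Finiteness of the extended ratio supplies the integrability, without which a bound on Bochner
integrals would be empty. -/
lemma moment_resampledTerm_le {δ κ : ℝ} (hκ : 0 ≤ κ)
    (h : lyapunovRatio δ K m d < ENNReal.ofReal κ) :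
    (∀ i, Integrable (fun x => |resampledTerm K m d i x| ^ (2 + δ)) (learnedLaw K d i)) ∧
      ∑ i, ∫ x, |resampledTerm K m d i x| ^ (2 + δ) ∂(learnedLaw K d i) ≤ κ := by
  rw [← sum_lintegral_resampledTerm m δ] at h
  have hmeas : ∀ i, Measurable fun x => |resampledTerm K m d i x| ^ (2 + δ) := fun i => by
    have := measurable_resampledTerm K m d i
    fun_prop
  have hfin : ∀ i, ∫⁻ x, ENNReal.ofReal (|resampledTerm K m d i x| ^ (2 + δ))
      ∂(learnedLaw K d i) < ∞ := fun i =>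
    ENNReal.sum_lt_top.mp (h.trans ENNReal.ofReal_lt_top) i (Finset.mem_univ i)
  refine ⟨fun i => ⟨(hmeas i).aestronglyMeasurable, ?_⟩, ?_⟩
  · rw [hasFiniteIntegral_iff_ofReal (Eventually.of_forall fun x => by positivity)]
    exact hfin i
  · have : ∀ i, ∫ x, |resampledTerm K m d i x| ^ (2 + δ) ∂(learnedLaw K d i)
        = (∫⁻ x, ENNReal.ofReal (|resampledTerm K m d i x| ^ (2 + δ))
          ∂(learnedLaw K d i)).toReal := fun i =>
      integral_eq_lintegral_of_nonneg_ae (Eventually.of_forall fun x => by positivity)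
        (hmeas i).aestronglyMeasurable
    simp_rw [this]
    rw [← ENNReal.toReal_sum fun i _ => (hfin i).ne]
    exact ENNReal.toReal_le_of_le_ofReal hκ h.le

/-- If the conditional law of the normalized resampled statistic is close to the standard normal
law and the normalized statistic is away from the normal quantile, the two tests agree. -/
lemma dCRTHatTest_eq_mx2HatTest {α η : ℝ} (hα0 : 0 < α) (hα1 : α < 1)
    (hV : 0 < resampleVar K m d)
    (hlo : ((resampleLaw K d).map (resampledStat K m d)).real
      (Set.Iic (√(resampleVar K m d) * (normalQuantile (1 - α) - η))) < 1 - α)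
    (hhi : 1 - α ≤ ((resampleLaw K d).map (resampledStat K m d)).real
      (Set.Iic (√(resampleVar K m d) * (normalQuantile (1 - α) + η))))
    (hη : 0 < η) (haway : η < |normStat K m d - normalQuantile (1 - α)|) :
    dCRTHatTest α K m d = mx2HatTest α K m d := by
  have hS : 0 < √(resampleVar K m d) := Real.sqrt_pos.mpr hV
  have hmeas : Measurable (resampledStat K m d) := by
    rw [resampledStat_eq_sum]
    exact Finset.measurable_sum _ fun i _ =>
      (measurable_resampledTerm K m d i).comp (measurable_pi_apply i)
  have := Measure.isProbabilityMeasure_map (μ := resampleLaw K d) hmeas.aemeasurable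
  -- The conditional quantile is enclosed between `Ŝ (z - η)` and `Ŝ (z + η)`, while `T` lies
  -- outside that interval.
  have h1 := le_quantile _ (by linarith) hlo
  have h2 := quantile_le _ (by linarith) hhi
  have hT : stat K m d = √(resampleVar K m d) * normStat K m d := by
    unfold normStat
    field_simp
  unfold dCRTHatTest mx2HatTest
  rcases lt_abs.mp haway with h | h
  · rw [if_pos, if_pos (by linarith)]
    rw [hT]
    refine lt_of_le_of_lt h2 ?_
    gcongr
    linarith
  · rw [if_neg, if_neg (by linarith)]
    rw [hT, gt_iff_lt, not_lt]
    refine le_trans ?_ h1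
    gcongr
    linarith

end Resample

/-- The tests agree wherever the conditional variance is bounded below, the Lyapunov ratio is small and
the normalized statistic is away from the normal quantile. -/
lemma exists_dCRTHatTest_eq_mx2HatTest {α δ ε η : ℝ} (hα0 : 0 < α) (hα1 : α < 1) (hδ : 0 < δ)
    (hε : 0 < ε) (hη : 0 < η) :
    ∃ κ : ℝ, 0 < κ ∧ ∀ {n p : ℕ} (K : LawLearner n p) [IsMarkovKernel K] (m : MeanLearner n p)
      (d : Sample n p), (∀ i, evariance id (learnedLaw K d i) < ∞) → ε ≤ resampleVar K m d →
      lyapunovRatio δ K m d < ENNReal.ofReal κ →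
      η < |normStat K m d - normalQuantile (1 - α)| →
      dCRTHatTest α K m d = mx2HatTest α K m d := by
  set z := normalQuantile (1 - α) with hz
  have hglo : (gaussianReal 0 1).real (Set.Iic (z - η)) < 1 - α :=
    measureReal_Iic_lt_of_lt_quantile _ (by linarith) (by rw [hz, normalQuantile]; linarith)
  have hghi : 1 - α < (gaussianReal 0 1).real (Set.Iic (z + η)) :=
    lt_measureReal_Iic_of_normalQuantile_lt (by linarith) (by linarith)
  -- The tolerances are the gaps between the normal distribution function at `z ± η` and the level
  -- `1 - α`.
  obtain ⟨κ₁, hκ₁, H₁⟩ := exists_lyapunov_bound hδ (z - η) (sub_pos.mpr hglo)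
  obtain ⟨κ₂, hκ₂, H₂⟩ := exists_lyapunov_bound hδ (z + η) (sub_pos.mpr hghi)
  -- From `Ŝ² ≥ ε`, the power `Ŝ ^ (2 + δ)` is at least `ε ^ (1 + δ / 2)`; this rescales the bound
  -- to the unnormalized ratio.
  refine ⟨min κ₁ κ₂ * ε ^ (1 + δ / 2), by positivity, ?_⟩
  intro n p K _ m d hfin hV hL haway
  have hVpos : 0 < resampleVar K m d := hε.trans_le hV
  obtain ⟨hint, hsum⟩ := moment_resampledTerm_le m (by positivity) hL
  have hSpow : ε ^ (1 + δ / 2) ≤ √(resampleVar K m d) ^ (2 + δ) := by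
    rw [Real.sqrt_eq_rpow, ← Real.rpow_mul hVpos.le]
    have : 1 / 2 * (2 + δ) = 1 + δ / 2 := by ring
    rw [this]
    gcongr
  have hsq : ∑ i, ∫ x, resampledTerm K m d i x ^ 2 ∂(learnedLaw K d i)
      = √(resampleVar K m d) ^ 2 := by
    rw [Real.sq_sqrt hVpos.le, resampleVar_eq_sum_integral m hfin]
  have hb₁ : ∑ i, ∫ x, |resampledTerm K m d i x| ^ (2 + δ) ∂(learnedLaw K d i)
      ≤ κ₁ * √(resampleVar K m d) ^ (2 + δ) :=
    hsum.trans (by gcongr; exact min_le_left _ _)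
  have hb₂ : ∑ i, ∫ x, |resampledTerm K m d i x| ^ (2 + δ) ∂(learnedLaw K d i)
      ≤ κ₂ * √(resampleVar K m d) ^ (2 + δ) :=
    hsum.trans (by gcongr; exact min_le_right _ _)
  have hlo := H₁ n (learnedLaw K d) inferInstance (resampledTerm K m d)
    (measurable_resampledTerm K m d) (fun i => memLp_resampledTerm m (hfin i))
    (fun i => integral_resampledTerm m (hfin i)) _ (Real.sqrt_pos.mpr hVpos) hsq hint hb₁
  have hhi := H₂ n (learnedLaw K d) inferInstance (resampledTerm K m d)
    (measurable_resampledTerm K m d) (fun i => memLp_resampledTerm m (hfin i))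
    (fun i => integral_resampledTerm m (hfin i)) _ (Real.sqrt_pos.mpr hVpos) hsq hint hb₂
  rw [← resampledStat_eq_sum, abs_lt] at hlo hhi
  refine dCRTHatTest_eq_mx2HatTest m hα0 hα1 hVpos (η := η) ?_ ?_ hη haway
  · have := hlo.2
    simp only [resampleLaw]
    linarith
  · have := hhi.1
    simp only [resampleLaw]
    linarith

/-! ### Measurability of the conditional variance -/

lemma measurable_evariance_learnedLaw {n p : ℕ} (K : LawLearner n p) [IsMarkovKernel K]
    (i : Fin n) : Measurable fun d : Sample n p => evariance id (learnedLaw K d i) := by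
  have hmean : Measurable fun a => ∫ x, x ∂(K a) :=
    (StronglyMeasurable.integral_kernel_prod_right' (κ := K)
      (f := fun y => y.2) (by fun_prop)).measurable
  have hevar : Measurable fun a => ∫⁻ x, ‖x - ∫ x', x' ∂(K a)‖ₑ ^ 2 ∂(K a) :=
    Measurable.lintegral_kernel_prod_right' (κ := K)
      (f := fun y => ‖y.2 - ∫ x', x' ∂(K y.1)‖ₑ ^ 2)
      ((measurable_snd.sub (hmean.comp measurable_fst)).enorm.pow_const 2)
  have hdata : Measurable fun d : Sample n p => (xzData d, (d i).2.2) := by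
    unfold xzData
    fun_prop
  exact hevar.comp hdata

lemma measurable_muHatY {n p : ℕ} {m : MeanLearner n p} (hm : Measurable (Function.uncurry m))
    (i : Fin n) : Measurable fun d : Sample n p => muHatY m d i := by
  have hdata : Measurable fun d : Sample n p => (yzData d, (d i).2.2) := by
    unfold yzData
    fun_prop
  exact hm.comp hdata

/-- Needed to pass from probability tending to one to a vanishing complement. The other exceptional
events are only bounded above, where outer measure suffices. -/
lemma nullMeasurableSet_le_resampleVar {n p : ℕ} {K : LawLearner n p} [IsMarkovKernel K]
    {m : MeanLearner n p} (hm : Measurable (Function.uncurry m)) {P : Measure (Sample n p)}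
    (hfin : ∀ᵐ d ∂P, ∀ i, evariance id (learnedLaw K d i) < ∞) (ε : ℝ) :
    NullMeasurableSet {d | ε ≤ resampleVar K m d} P := by
  have hmeas : Measurable fun d : Sample n p =>
      ∑ i, ((√(n : ℝ))⁻¹ * ((d i).2.1 - muHatY m d i)) ^ 2 *
        (evariance id (learnedLaw K d i)).toReal := by
    refine Finset.measurable_sum _ fun i _ => ?_
    have h1 := measurable_evariance_learnedLaw K i
    have h2 := measurable_muHatY hm i
    fun_prop
  have hae : AEMeasurable (resampleVar K m) P :=
    ⟨_, hmeas, hfin.mono fun d hd => resampleVar_eq_sum_evariance m hd⟩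
  exact nullMeasurableSet_le aemeasurable_const hae

/-- An event whose complement has vanishing outer probability has probability tending to one. -/
lemma tendsto_measure_one_of_compl {Ω : ℕ → Type*} [∀ n, MeasurableSpace (Ω n)]
    {P : ∀ n, Measure (Ω n)} [∀ n, IsProbabilityMeasure (P n)] {A : ∀ n, Set (Ω n)}
    (h : Tendsto (fun n => P n (A n)ᶜ) atTop (𝓝 0)) :
    Tendsto (fun n => P n (A n)) atTop (𝓝 1) := by
  have h1 : Tendsto (fun n => 1 - P n (A n)ᶜ) atTop (𝓝 1) := by
    simpa using ENNReal.Tendsto.sub (tendsto_const_nhds (x := (1 : ℝ≥0∞))) h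
      (Or.inl ENNReal.one_ne_top)
  refine tendsto_of_tendsto_of_tendsto_of_le_of_le h1 tendsto_const_nhds (fun n => ?_)
    fun n => prob_le_one
  rw [tsub_le_iff_right]
  calc (1 : ℝ≥0∞) = P n (A n ∪ (A n)ᶜ) := by rw [Set.union_compl_self, measure_univ]
    _ ≤ _ := measure_union_le _ _

end DCRT

end

/-! ### Union bound over the three exceptional events -/

theorem corollary1
    (α : ℝ) (hα0 : 0 < α) (hα1 : α < 1)
    -- the dimension of the covariates may change with the sample size
    (p : ℕ → ℕ)
    -- the true laws
    (L : ∀ n, Measure (DCRT.Obs (p n))) [∀ n, IsProbabilityMeasure (L n)]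
    -- the learned laws of the predictor and the learned outcome regressions
    (K : ∀ n, DCRT.LawLearner n (p n)) [∀ n, IsMarkovKernel (K n)]
    (m : ∀ n, DCRT.MeanLearner n (p n))
    (hm : ∀ n, Measurable (Function.uncurry (m n)))
    -- the conditional variance of the resampled statistic is bounded below
    (hNDG1 : ∃ ε : ℝ, 0 < ε ∧
      Tendsto (fun n => DCRT.sampleLaw n (L n) {d | ε ≤ DCRT.resampleVar (K n) (m n) d})
        atTop (𝓝 1))
    -- nondegenerate, finite learned variances and nonzero residuals
    (hNDG2 : ∀ n, ∀ᵐ d ∂(DCRT.sampleLaw n (L n)), ∀ i : Fin n,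
      (0 < evariance id (DCRT.learnedLaw (K n) d i) ∧
        evariance id (DCRT.learnedLaw (K n) d i) < ∞) ∧
      0 < ((d i).2.1 - DCRT.muHatY (m n) d i) ^ 2 ∧
      0 < ((d i).2.1 - DCRT.muY (L n) (d i).2.2) ^ 2)
    -- the conditional Lyapunov condition
    (hLyap : ∃ δ : ℝ, 0 < δ ∧
      DCRT.TendstoZeroInProb (fun n => DCRT.sampleLaw n (L n))
        (fun n d => DCRT.lyapunovRatio δ (K n) (m n) d))
    -- the normalized statistic does not accumulate near the normal quantile
    (hacc : Tendsto
      (fun δ : ℝ => limsup (fun n => DCRT.sampleLaw n (L n)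
        {d | |DCRT.normStat (K n) (m n) d - DCRT.normalQuantile (1 - α)| ≤ δ}) atTop)
      (𝓝[>] 0) (𝓝 0)) :
    Tendsto (fun n => DCRT.sampleLaw n (L n)
        {d | DCRT.dCRTHatTest α (K n) (m n) d = DCRT.mx2HatTest α (K n) (m n) d})
      atTop (𝓝 1) := by
  obtain ⟨ε, hε, hV⟩ := hNDG1
  obtain ⟨δ, hδ, hL⟩ := hLyap
  have hfin : ∀ n, ∀ᵐ d ∂(DCRT.sampleLaw n (L n)), ∀ i,
      evariance id (DCRT.learnedLaw (K n) d i) < ∞ := fun n =>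
    (hNDG2 n).mono fun d hd i => (hd i).1.2
  have hVc : Tendsto (fun n => DCRT.sampleLaw n (L n)
      {d | ε ≤ DCRT.resampleVar (K n) (m n) d}ᶜ) atTop (𝓝 0) := by
    have h1 := ENNReal.Tendsto.sub (tendsto_const_nhds (x := (1 : ℝ≥0∞))) hV
      (Or.inl ENNReal.one_ne_top)
    rw [tsub_self] at h1
    refine h1.congr fun n => ?_
    rw [prob_compl_eq_one_sub₀ (DCRT.nullMeasurableSet_le_resampleVar (hm n) (hfin n) ε)]
  refine DCRT.tendsto_measure_one_of_compl (ENNReal.tendsto_nhds_zero.mpr fun e he => ?_)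
  have he2 : 0 < e / 2 := ENNReal.half_pos he.ne'
  -- The width `η` is fixed first, by non-accumulation; only then is `κ` chosen, and `n` last.
  obtain ⟨η, hηlim, hη⟩ := ((hacc.eventually_lt_const he2).and self_mem_nhdsWithin).exists
  obtain ⟨κ, hκ, H⟩ := DCRT.exists_dCRTHatTest_eq_mx2HatTest hα0 hα1 hδ hε hη
  have hsum := hVc.add (hL (ENNReal.ofReal κ) (ENNReal.ofReal_pos.mpr hκ))
  rw [add_zero] at hsum
  filter_upwards [eventually_lt_of_limsup_lt hηlim, hsum.eventually_lt_const he2] with n hn1 hn2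
  calc DCRT.sampleLaw n (L n)
        {d | DCRT.dCRTHatTest α (K n) (m n) d = DCRT.mx2HatTest α (K n) (m n) d}ᶜ
      ≤ DCRT.sampleLaw n (L n) (({d | ε ≤ DCRT.resampleVar (K n) (m n) d}ᶜ ∪
          {d | ENNReal.ofReal κ ≤ DCRT.lyapunovRatio δ (K n) (m n) d}) ∪
          {d | |DCRT.normStat (K n) (m n) d - DCRT.normalQuantile (1 - α)| ≤ η}) := by
        refine measure_mono_ae ((hfin n).mono fun d hd hne => ?_)
        by_contra hnot
        obtain ⟨hnot, haway⟩ := not_or.mp hnot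
        obtain ⟨hvar, hratio⟩ := not_or.mp hnot
        exact hne (H (K n) (m n) d hd (not_not.mp hvar) (not_le.mp hratio) (not_le.mp haway))
    _ ≤ (DCRT.sampleLaw n (L n) {d | ε ≤ DCRT.resampleVar (K n) (m n) d}ᶜ +
          DCRT.sampleLaw n (L n) {d | ENNReal.ofReal κ ≤ DCRT.lyapunovRatio δ (K n) (m n) d}) +
          DCRT.sampleLaw n (L n)
            {d | |DCRT.normStat (K n) (m n) d - DCRT.normalQuantile (1 - α)| ≤ η} :=
        (measure_union_le _ _).trans (add_le_add_left (measure_union_le _ _) _)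
    _ ≤ e / 2 + e / 2 := add_le_add hn2.le hn1.le
    _ = e := ENNReal.add_halves e
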